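/- **Model.** There are $M\ge 1$ messages and $K\ge 1$ contexts. In each of the timeslots $t=1,\dots,T$ a group of $N\ge 1$ users arrives; user $n$ has a context $x_t(n)\in[1:K]$. The $N$ users are divided (at random or not) into $\tau$ subgroups $\mathcal N_{1},\dots,\mathcal N_{\tau}$ whose sizes are $N/\tau$ (rounded down, or the integer after that, if $\tau\nmid N$); the divisions of different timeslots are i.i.d. and independent of the contexts. The server observes the contexts and the subgroups, sends one message to each subgroup ($\tau$ broadcast transmissions, $1\le\tau\le N$), and then observes the payoff of every user. A user with context $k$ who is served message $m$ yields a payoff in $[0,1]$ drawn, independently over users and timeslots, from an unknown distribution $\mathcal P_{k,m}$ with mean $\mu(k,m)$. All the means are positive integer multiples of some $\Delta\ge\underline\Delta$, where $\underline\Delta>0$ is known. *Uniform context arrivals* means that the contexts of all users in all timeslots are independent and uniform on $[1:K]$. The learning regret of an online strategy, which serves user $n$ in timeslot $t$ the message $a_t(n)$ and thereby obtains the payoff $r_t(n)$, is $$R(T)=\mathbb E\sum_{t=1}^{T}\Big[\sum_{s=1}^{\tau}\max_{m\in[1:M]}\sum_{n\in\mathcal N_s}\mu(x_t(n),m)-\sum_{n=1}^{N}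 r_t(n)\Big].$$ **Theorem.** For every $\underline\Delta>0$ there is a constant $C>0$, depending only on $\underline\Delta$, such that the following holds for all $M,N,K,\tau,T$ under uniform context arrivals. 1. Let $1\le\tau<N$ and $F=\frac{MN^2K}{\tau^2}\log(MNKT)$. If $F\ge N$, there is an online strategy (depending on $M,N,K,\tau,T,\underline\Delta$ but not on the unknown distributions) whose learning regret satisfies $R(T)\le C\,\frac{MN^2K}{\tau^2}\log(MNKT)$ for all payoff distributions and all rules of division as above. 2. Let $\tau=N$ and $F=MK\log(NT/K)$. If $F\ge N$ and $NT\ge 2K$, there is likewise an online strategy with $R(T)\le C\,MK\log(NT/K)$. The conditions on $F$ and on $NT/K$ hold for all sufficiently large $T$. The bound for $\tau$ transmissions is thus $1/\tau^2$ times that for one transmission, when $1\le\tau<N$. -/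

import Mathlib

open MeasureTheory
open scoped ENNReal

/-- A division of `N` users into `τ` subgroups (`g n` is the subgroup of user `n`) is balanced if
every subgroup has `⌊N / τ⌋` or `⌊N / τ⌋ + 1` users.  When `τ` divides `N` this forces every
subgroup to have exactly `N / τ` users. -/
def IsBalanced {N τ : ℕ} (g : Fin N → Fin τ) : Prop :=
  ∀ s : Fin τ, (Finset.univ.filter fun n => g n = s).card = N / τ ∨
    (Finset.univ.filter fun n => g n = s).card = N / τ + 1

/-- An instance of the contextual broadcast bandit with `M` messages, `N` users per timeslot, `K`
contexts and `τ` broadcast transmissions per timeslot. -/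
structure BroadcastBandit (M N K τ : ℕ) where
  /-- the law of the vector of contexts of the `N` users of one timeslot -/
  arrivals : PMF (Fin N → Fin K)
  /-- the law of the division of the users of one timeslot into `τ` subgroups -/
  split : PMF (Fin N → Fin τ)
  split_balanced : ∀ g ∈ split.support, IsBalanced g
  /-- the law of the payoff of message `m` for a user with context `k` -/
  payoff : Fin K → Fin M → Measure ℝ
  payoff_prob : ∀ k m, IsProbabilityMeasure (payoff k m)
  payoff_mem : ∀ k m, ∀ᵐ r ∂(payoff k m), r ∈ Set.Icc (0 : ℝ) 1

/-- Everything that is random in one timeslot: the contexts of the users, the division into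
subgroups, and the payoff that each user would give under each context and each message. -/
abbrev Slot (M N K τ : ℕ) : Type :=
  (Fin N → Fin K) × (Fin N → Fin τ) × (Fin N → Fin K → Fin M → ℝ)

/-- What the server knows about one completed timeslot: the contexts, the division into subgroups,
the message sent to each subgroup, and the payoff received from each user. -/
abbrev Observation (M N K τ : ℕ) : Type :=
  (Fin N → Fin K) × (Fin N → Fin τ) × (Fin τ → Fin M) × (Fin N → ℝ)

/-- An online strategy: from the observations of the completed timeslots and the current contexts
and subgroups, it picks one message for each subgroup. -/
structure Strategy (M N K τ : ℕ) where
  choose : (t : ℕ) → (Fin t → Observation M N K τ) → (Fin N → Fin K) → (Fin N → Fin τ) →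
    Fin τ → Fin M
  measurable_choose : ∀ t : ℕ, Measurable
    fun p : (Fin t → Observation M N K τ) × (Fin N → Fin K) × (Fin N → Fin τ) =>
      choose t p.1 p.2.1 p.2.2

namespace Strategy

/-- The observation that one timeslot produces when message `a s` is sent to subgroup `s`. -/
def observe {M N K τ : ℕ} (z : Slot M N K τ) (a : Fin τ → Fin M) : Observation M N K τ :=
  (z.1, z.2.1, a, fun n => z.2.2 n (z.1 n) (a (z.2.1 n)))

/-- The observations of the first `t` timeslots (numbered from `0`) along the sample path `ω`. -/
def history {M N K τ : ℕ} (π : Strategy M N K τ) (ω : ℕ → Slot M N K τ) :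
    (t : ℕ) → Fin t → Observation M N K τ
  | 0 => Fin.elim0
  | t + 1 => Fin.snoc (α := fun _ => Observation M N K τ) (history π ω t)
      (observe (ω t) (π.choose t (history π ω t) (ω t).1 (ω t).2.1))

/-- The message sent to each subgroup in timeslot `t` along the sample path `ω`. -/
def message {M N K τ : ℕ} (π : Strategy M N K τ) (ω : ℕ → Slot M N K τ) (t : ℕ) :
    Fin τ → Fin M :=
  π.choose t (π.history ω t) (ω t).1 (ω t).2.1

theorem measurable_table {M N K : ℕ} (n : Fin N) :
    Measurable fun p : (Fin N → Fin K → Fin M → ℝ) × (Fin K × Fin M) => p.1 n p.2.1 p.2.2 := by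
  refine measurable_from_prod_countable_left fun q => ?_
  exact (measurable_pi_apply q.2).comp ((measurable_pi_apply q.1).comp (measurable_pi_apply n))

theorem measurable_observe {M N K τ : ℕ} :
    Measurable fun p : Slot M N K τ × (Fin τ → Fin M) => observe p.1 p.2 := by
  unfold observe
  refine Measurable.prodMk (by fun_prop) (Measurable.prodMk (by fun_prop)
    (Measurable.prodMk (by fun_prop) ?_))
  rw [measurable_pi_iff]
  intro n
  refine (measurable_table n).comp (Measurable.prodMk (by fun_prop)
    (Measurable.prodMk (by fun_prop) ?_))
  have h : Measurable fun q : (Fin N → Fin τ) × (Fin τ → Fin M) => q.2 (q.1 n) :=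
    measurable_of_finite _
  exact h.comp (Measurable.prodMk (by fun_prop) (by fun_prop))

theorem measurable_next {M N K τ : ℕ} (π : Strategy M N K τ) (t : ℕ)
    (h : Measurable fun ω : ℕ → Slot M N K τ => π.history ω t) :
    Measurable fun ω : ℕ → Slot M N K τ => π.choose t (π.history ω t) (ω t).1 (ω t).2.1 :=
  (π.measurable_choose t).comp (h.prodMk (Measurable.prodMk (by fun_prop) (by fun_prop)))

theorem measurable_history {M N K τ : ℕ} (π : Strategy M N K τ) (t : ℕ) :
    Measurable fun ω : ℕ → Slot M N K τ => π.history ω t := by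
  induction t with
  | zero =>
    have h : (fun ω : ℕ → Slot M N K τ => π.history ω 0) = fun _ => Fin.elim0 := rfl
    rw [h]
    exact measurable_const
  | succ t ih =>
    rw [measurable_pi_iff]
    intro i
    refine Fin.lastCases ?_ (fun i => ?_) i
    · simp only [history, Fin.snoc_last]
      have h1 : Measurable fun ω : ℕ → Slot M N K τ => ω t := measurable_pi_apply t
      exact measurable_observe.comp (h1.prodMk (π.measurable_next t ih))
    · simp only [history, Fin.snoc_castSucc]
      exact (measurable_pi_apply i).comp ih

theorem measurable_message {M N K τ : ℕ} (π : Strategy M N K τ) (t : ℕ) :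
    Measurable fun ω : ℕ → Slot M N K τ => π.message ω t :=
  π.measurable_next t (π.measurable_history t)

end Strategy

namespace BroadcastBandit

/-- The expected payoff `μ(k, m)`. -/
noncomputable def mean {M N K τ : ℕ} (B : BroadcastBandit M N K τ) (k : Fin K) (m : Fin M) : ℝ :=
  ∫ r, r ∂(B.payoff k m)

/-- Uniform context arrivals: all `K ^ N` context vectors are equally likely, that is, the contexts
of the `N` users are independent and uniform on the `K` contexts. -/
def UniformArrivals {M N K τ : ℕ} (B : BroadcastBandit M N K τ) : Prop :=
  ∀ x : Fin N → Fin K, B.arrivals x = ((K : ℝ≥0∞) ^ N)⁻¹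

/-- The discrete payoff structure: all expected payoffs are positive integer multiples of one number
`Δ ≥ δ`.  (They are at most `1` because payoffs lie in `[0, 1]`.) -/
def DiscretePayoffs {M N K τ : ℕ} (B : BroadcastBandit M N K τ) (δ : ℝ) : Prop :=
  ∃ Δ : ℝ, δ ≤ Δ ∧ ∀ k m, ∃ j : ℕ, 1 ≤ j ∧ B.mean k m = j * Δ

/-- The law of one timeslot: contexts, division into subgroups and the payoffs of the different
users, contexts and messages are independent. -/
noncomputable def slotLaw {M N K τ : ℕ} (B : BroadcastBandit M N K τ) : Measure (Slot M N K τ) :=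
  B.arrivals.toMeasure.prod (B.split.toMeasure.prod
    (Measure.pi fun _ : Fin N => Measure.pi fun k : Fin K => Measure.pi fun m : Fin M =>
      B.payoff k m))

instance {M N K τ : ℕ} (B : BroadcastBandit M N K τ) : IsProbabilityMeasure B.slotLaw := by
  have := B.payoff_prob
  unfold slotLaw
  infer_instance

/-- The law of the whole process: the timeslots are independent and identically distributed. -/
noncomputable def law {M N K τ : ℕ} (B : BroadcastBandit M N K τ) :
    Measure (ℕ → Slot M N K τ) :=
  Measure.infinitePi fun _ => B.slotLaw

/-- The largest expected total payoff of the users with contexts `x`, divided into the subgroups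
`g`, when every subgroup is sent the message that is best for that subgroup. -/
noncomputable def best {M N K τ : ℕ} (B : BroadcastBandit M N K τ) (x : Fin N → Fin K)
    (g : Fin N → Fin τ) : ℝ :=
  ∑ s : Fin τ, ⨆ m : Fin M, ∑ n ∈ Finset.univ.filter (fun n => g n = s), B.mean (x n) m

/-- The payoff lost in the first `T` timeslots along the sample path `ω`. -/
noncomputable def pathRegret {M N K τ : ℕ} (B : BroadcastBandit M N K τ) (π : Strategy M N K τ)
    (T : ℕ) (ω : ℕ → Slot M N K τ) : ℝ :=
  ∑ t ∈ Finset.range T, (B.best (ω t).1 (ω t).2.1 -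
    ∑ n : Fin N, (ω t).2.2 n ((ω t).1 n) (π.message ω t ((ω t).2.1 n)))

/-- The learning regret `R(T)`. -/
noncomputable def regret {M N K τ : ℕ} (B : BroadcastBandit M N K τ) (π : Strategy M N K τ)
    (T : ℕ) : ℝ :=
  ∫ ω, B.pathRegret π T ω ∂B.law

theorem ae_payoff_mem {M N K τ : ℕ} (B : BroadcastBandit M N K τ) (t : ℕ) :
    ∀ᵐ ω ∂B.law, ∀ n k m, (ω t).2.2 n k m ∈ Set.Icc (0 : ℝ) 1 := by
  have := B.payoff_prob
  have h1 : MeasurePreserving (fun ω : ℕ → Slot M N K τ => ω t) B.law B.slotLaw :=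
    measurePreserving_eval_infinitePi (fun _ : ℕ => B.slotLaw) t
  simp only [ae_all_iff]
  intro n k m
  have h2 : Measure.QuasiMeasurePreserving (fun z : Slot M N K τ => z.2.2 n k m) B.slotLaw
      (B.payoff k m) := by
    have e1 := (measurePreserving_eval (fun m : Fin M => B.payoff k m) m).quasiMeasurePreserving
    have e2 := (measurePreserving_eval
      (fun k : Fin K => Measure.pi fun m : Fin M => B.payoff k m) k).quasiMeasurePreserving
    have e3 := (measurePreserving_eval (fun _ : Fin N => Measure.pi fun k : Fin K =>
      Measure.pi fun m : Fin M => B.payoff k m) n).quasiMeasurePreserving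
    exact e1.comp (e2.comp (e3.comp (Measure.quasiMeasurePreserving_snd.comp
      Measure.quasiMeasurePreserving_snd)))
  exact (h2.comp h1.quasiMeasurePreserving).ae (B.payoff_mem k m)

/-- The integral in `regret` is never a junk value. -/
theorem integrable_pathRegret {M N K τ : ℕ} (B : BroadcastBandit M N K τ) (π : Strategy M N K τ)
    (T : ℕ) : Integrable (B.pathRegret π T) B.law := by
  have : IsProbabilityMeasure B.law := by unfold law; infer_instance
  unfold pathRegret
  refine integrable_finsetSum _ fun t _ => Integrable.sub ?_ (integrable_finsetSum _ fun n _ => ?_)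
  · have hm : Measurable fun ω : ℕ → Slot M N K τ => ((ω t).1, (ω t).2.1) :=
      Measurable.prodMk (by fun_prop) (by fun_prop)
    have : IsProbabilityMeasure (B.law.map fun ω => ((ω t).1, (ω t).2.1)) :=
      Measure.isProbabilityMeasure_map hm.aemeasurable
    have hi : Integrable (fun p : (Fin N → Fin K) × (Fin N → Fin τ) => B.best p.1 p.2)
        (B.law.map fun ω => ((ω t).1, (ω t).2.1)) := Integrable.of_finite
    exact hi.comp_measurable hm
  · have hm : Measurable fun ω : ℕ → Slot M N K τ =>
        (ω t).2.2 n ((ω t).1 n) (π.message ω t ((ω t).2.1 n)) := by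
      have h1 : Measurable fun ω : ℕ → Slot M N K τ => ω t := measurable_pi_apply t
      have h2 : Measurable fun ω : ℕ → Slot M N K τ =>
          Strategy.observe (ω t) (π.message ω t) :=
        Strategy.measurable_observe.comp (h1.prodMk (π.measurable_message t))
      exact (measurable_pi_apply n).comp h2.snd.snd.snd
    refine Integrable.of_bound hm.aestronglyMeasurable 1 ?_
    filter_upwards [B.ae_payoff_mem t] with ω hω
    obtain ⟨h0, h1⟩ := hω n ((ω t).1 n) (π.message ω t ((ω t).2.1 n))
    rw [Real.norm_eq_abs, abs_of_nonneg h0]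
    exact h1

end BroadcastBandit

/- The strategy explores first and then commits. During `L ≈ M N K Λ / τ²` timeslots, each of which
costs at most `N`, the messages are sent round-robin. The number of users who get to reveal
`μ(k, m)` is random, because their contexts are; since the contexts are uniform and independent of
the payoffs, the exponential moment in Hoeffding's inequality can be averaged over them, and
`μ(k, m)` is misestimated by `ε` with probability at most `2 exp (-Λ)`. Afterwards each subgroup is
served the message that maximises the sum of the estimated means. All means are multiples of some
`Δ ≥ δ`, so for `ε = δ / (2 (⌊N / τ⌋ + 1))` this message is optimal for the true means, unless one
of the means relevant to the subgroup is misestimated. Taking `Λ = 2 log (M N K T)`, respectively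
`Λ = log (N T / K)`, balances the two phases. -/

section Probability

open ProbabilityTheory

variable {Ω : Type*} [MeasurableSpace Ω] {μ : Measure Ω}

theorem integrable_comp_of_finite {α : Type*} [Finite α] [MeasurableSpace α]
    [MeasurableSingletonClass α] [IsFiniteMeasure μ] {X : Ω → α} (hX : Measurable X) (f : α → ℝ) :
    Integrable (fun ω => f (X ω)) μ :=
  Integrable.of_finite.comp_measurable hX

theorem ae_mem_support {α : Type*} [MeasurableSpace α] [MeasurableSingletonClass α] [Countable α]
    (p : PMF α) : ∀ᵐ a ∂p.toMeasure, a ∈ p.support := by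
  rw [ae_iff, PMF.toMeasure_apply_eq_zero_iff _ (Set.to_countable _).measurableSet]
  exact Set.disjoint_left.2 fun a h h' => h' h

theorem indepFun_comp_measurePreserving {Ω' α β : Type*} [MeasurableSpace Ω'] [MeasurableSpace α]
    [MeasurableSpace β] {ν : Measure Ω'} {φ : Ω → Ω'} (hφ : MeasurePreserving φ μ ν) {X : Ω' → α}
    {Y : Ω' → β} (hX : Measurable X) (hY : Measurable Y) (h : IndepFun X Y ν) :
    IndepFun (fun ω => X (φ ω)) (fun ω => Y (φ ω)) μ := by
  rw [indepFun_iff_measure_inter_preimage_eq_mul] at h ⊢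
  intro s t hs ht
  have key := h s t hs ht
  rw [← hφ.measure_preimage (hX hs).nullMeasurableSet,
    ← hφ.measure_preimage (hY ht).nullMeasurableSet,
    ← hφ.measure_preimage ((hX hs).inter (hY ht)).nullMeasurableSet] at key
  exact key

theorem indepFun_prodMk_left [IsFiniteMeasure μ] {α β γ : Type*} [MeasurableSpace α]
    [MeasurableSpace β] [MeasurableSpace γ] {X : Ω → α} {Y : Ω → β} {Z : Ω → γ}
    (hX : Measurable X) (hY : Measurable Y) (hZ : Measurable Z)
    (h : IndepFun X (fun ω => (Y ω, Z ω)) μ) (hYZ : IndepFun Y Z μ) :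
    IndepFun (fun ω => (X ω, Y ω)) Z μ := by
  have hXY : IndepFun X Y μ := h.comp measurable_id measurable_fst
  rw [indepFun_iff_map_prod_eq_prod_map_map (hX.prodMk hY).aemeasurable hZ.aemeasurable,
    hXY.map_prod_eq_prod_map_map hX.aemeasurable hY.aemeasurable]
  apply (MeasurableEquiv.prodAssoc.map_measurableEquiv_injective)
  rw [Measure.prodAssoc_prod, ← hYZ.map_prod_eq_prod_map_map hY.aemeasurable hZ.aemeasurable,
    ← h.map_prod_eq_prod_map_map hX.aemeasurable (hY.prodMk hZ).aemeasurable,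
    Measure.map_map MeasurableEquiv.prodAssoc.measurable ((hX.prodMk hY).prodMk hZ)]
  rfl

theorem apply_eq_sum_indicator_mul {α ι : Type*} [Fintype ι] (b : α → ι) (Y : ι → α → ℝ) (a : α) :
    Y (b a) a = ∑ i, ({i} : Set ι).indicator 1 (b a) * Y i a := by
  classical
  simp [Set.indicator_apply]

section RandomIndex

variable {ι : Type*} [Finite ι] [MeasurableSpace ι] [MeasurableSingletonClass ι] {b : Ω → ι}
  {Y : ι → Ω → ℝ}

theorem integrable_apply_of_finite (hb : Measurable b) (hY : ∀ i, Integrable (Y i) μ) :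
    Integrable (fun ω => Y (b ω) ω) μ := by
  cases nonempty_fintype ι
  simp only [apply_eq_sum_indicator_mul b Y]
  refine integrable_finsetSum _ fun i _ => (hY i).bdd_mul (c := 1) ?_ ?_
  · exact ((measurable_one.indicator (measurableSet_singleton i)).comp hb).aestronglyMeasurable
  · exact .of_forall fun ω => (norm_indicator_le_norm_self _ _).trans (by simp)

theorem integral_apply_eq_of_indepFun [IsFiniteMeasure μ] (hb : Measurable b)
    (hY : ∀ i, Integrable (Y i) μ) (h : ∀ i, IndepFun b (Y i) μ) :
    ∫ ω, Y (b ω) ω ∂μ = ∫ ω, ∫ ω', Y (b ω) ω' ∂μ ∂μ := by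
  cases nonempty_fintype ι
  have hind : ∀ i, Integrable (fun ω => ({i} : Set ι).indicator (1 : ι → ℝ) (b ω)) μ := fun i =>
    integrable_comp_of_finite hb _
  have hindep : ∀ i, IndepFun (fun ω => ({i} : Set ι).indicator (1 : ι → ℝ) (b ω)) (Y i) μ :=
    fun i => (h i).comp (measurable_of_finite (({i} : Set ι).indicator 1)) measurable_id
  have hmul : ∀ i, Integrable (fun ω => ({i} : Set ι).indicator (1 : ι → ℝ) (b ω) * Y i ω) μ :=
    fun i => (hindep i).integrable_mul (hind i) (hY i)
  simp only [apply_eq_sum_indicator_mul b Y,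
    apply_eq_sum_indicator_mul b fun i _ => ∫ ω', Y i ω' ∂μ]
  rw [integral_finsetSum _ fun i _ => hmul i, integral_finsetSum _ fun i _ => (hind i).mul_const _]
  refine Finset.sum_congr rfl fun i _ => ?_
  rw [(hindep i).integral_fun_mul_eq_mul_integral (hind i).aestronglyMeasurable
    (hY i).aestronglyMeasurable, integral_mul_const]

end RandomIndex

theorem lintegral_pi_prod {ι : Type*} [Fintype ι] {E : ι → Type*} [∀ i, MeasurableSpace (E i)]
    (μ : ∀ i, Measure (E i)) [∀ i, IsProbabilityMeasure (μ i)] {f : ∀ i, E i → ℝ≥0∞}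
    (hf : ∀ i, Measurable (f i)) :
    ∫⁻ x, ∏ i, f i (x i) ∂Measure.pi μ = ∏ i, ∫⁻ x, f i x ∂μ i := by
  rw [lintegral_prod_eq_prod_lintegral_of_indepFun Finset.univ (fun i (x : ∀ i, E i) => f i (x i))
    (iIndepFun_pi fun i => (hf i).aemeasurable) (by fun_prop)]
  exact Finset.prod_congr rfl fun i _ => (measurePreserving_eval μ i).lintegral_comp (hf i)

theorem lintegral_ite_ofReal_le_exp [IsProbabilityMeasure μ] {A : Set Ω} [DecidablePred (· ∈ A)]
    (hA : MeasurableSet A) {y : ℝ} (hy : y ≤ 1) :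
    ∫⁻ ω, (if ω ∈ A then ENNReal.ofReal (1 - y) else 1) ∂μ ≤
      ENNReal.ofReal (Real.exp (-(y * μ.real A))) := by
  have hcompl : μ.real Aᶜ = 1 - μ.real A := probReal_compl_eq_one_sub hA
  calc ∫⁻ ω, (if ω ∈ A then ENNReal.ofReal (1 - y) else 1) ∂μ
      = ENNReal.ofReal (1 - y) * μ A + μ Aᶜ := by
        rw [← lintegral_add_compl _ hA, setLIntegral_congr_fun hA fun ω hω => if_pos hω,
          setLIntegral_congr_fun hA.compl fun ω hω => if_neg hω]
        simp
    _ = ENNReal.ofReal ((1 - y) * μ.real A + μ.real Aᶜ) := by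
        rw [ENNReal.ofReal_add (mul_nonneg (by linarith) measureReal_nonneg) measureReal_nonneg,
          ENNReal.ofReal_mul (by linarith), ofReal_measureReal, ofReal_measureReal]
    _ ≤ ENNReal.ofReal (Real.exp (-(y * μ.real A))) := by
        refine ENNReal.ofReal_le_ofReal ?_
        rw [hcompl]
        linarith [Real.add_one_le_exp (-(y * μ.real A))]

theorem exp_neg_two_mul_le_one_sub {y : ℝ} (h0 : 0 ≤ y) (h1 : y ≤ 1 / 2) :
    Real.exp (-2 * y) ≤ 1 - y := by
  have hexp : (1 + 2 * y) * Real.exp (-2 * y) ≤ 1 := by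
    calc (1 + 2 * y) * Real.exp (-2 * y) ≤ Real.exp (2 * y) * Real.exp (-2 * y) := by
          gcongr
          linarith [Real.add_one_le_exp (2 * y)]
      _ = 1 := by rw [← Real.exp_add]; simp
  nlinarith [Real.exp_pos (-2 * y)]

/-- The exponent `4 ε` is the optimal one in Hoeffding's lemma. -/
theorem lintegral_exp_deviation_le (P : Measure ℝ) [IsProbabilityMeasure P]
    (hP : ∀ᵐ r ∂P, r ∈ Set.Icc (0 : ℝ) 1) (ε : ℝ) {σ : ℝ} (hσ : σ ^ 2 = 1) :
    ∫⁻ r, ENNReal.ofReal (Real.exp (4 * ε * (σ * (r - ∫ r, r ∂P) - ε))) ∂P ≤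
      ENNReal.ofReal (Real.exp (-2 * ε ^ 2)) := by
  have hsub := hasSubgaussianMGF_of_mem_Icc (X := fun r : ℝ => r) measurable_id.aemeasurable hP
  have hsplit : ∀ r : ℝ, Real.exp (4 * ε * (σ * (r - ∫ r, r ∂P) - ε)) =
      Real.exp (4 * ε * σ * (r - ∫ r, r ∂P)) * Real.exp (-4 * ε ^ 2) := fun r => by
    rw [← Real.exp_add]; ring_nf
  simp only [hsplit]
  rw [← ofReal_integral_eq_lintegral_ofReal ((hsub.integrable_exp_mul _).mul_const _)
    (.of_forall fun r => by positivity), integral_mul_const]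
  refine ENNReal.ofReal_le_ofReal ?_
  refine (mul_le_mul_of_nonneg_right (hsub.mgf_le (4 * ε * σ)) (Real.exp_pos _).le).trans ?_
  rw [← Real.exp_add, Real.exp_le_exp, mul_pow, hσ]
  push_cast
  simp only [sub_zero, norm_one]
  linarith

end Probability

open scoped Finset

section Argmax

variable {ι : Type*} [Nonempty ι]

/-- A maximizer of `f`. It depends on `f` only through the set of all maximizers, which makes it
measurable in `f`. -/
noncomputable def argmax (f : ι → ℝ) : ι :=
  Classical.epsilon fun i => ∀ j, f j ≤ f i

variable [Finite ι]

theorem le_argmax (f : ι → ℝ) (i : ι) : f i ≤ f (argmax f) :=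
  Classical.epsilon_spec (p := fun i => ∀ j, f j ≤ f i) (Finite.exists_max f) i

theorem measurable_argmax [MeasurableSpace ι] : Measurable (argmax : (ι → ℝ) → ι) := by
  have hmax : Measurable fun (f : ι → ℝ) (i : ι) => ∀ j, f j ≤ f i :=
    measurable_pi_iff.2 fun i => Measurable.forall fun j => measurableSet_setOfPred.1 <|
      measurableSet_le (measurable_pi_apply j) (measurable_pi_apply i)
  exact (measurable_of_finite Classical.epsilon).comp hmax

theorem lt_apply_argmax_add {f f' : ι → ℝ} {η : ℝ} (h : ∀ i, |f' i - f i| < η / 2) (i : ι) :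
    f i < f (argmax f') + η := by
  have hi := abs_lt.1 (h i)
  have hmax := abs_lt.1 (h (argmax f'))
  linarith [le_argmax f' i]

end Argmax

theorem IsBalanced.card_le {N τ : ℕ} {g : Fin N → Fin τ} (hg : IsBalanced g) (s : Fin τ) :
    #{n | g n = s} ≤ N / τ + 1 := by
  rcases hg s with h | h <;> omega

theorem IsBalanced.mul_card_le {N τ : ℕ} {g : Fin N → Fin τ} (hg : IsBalanced g)
    (S : Finset (Fin τ)) : N / τ * #S ≤ #{n | g n ∈ S} := by
  have hfiber : ∀ s ∈ S, N / τ ≤ #{n ∈ ({n | g n ∈ S} : Finset (Fin N)) | g n = s} := by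
    intro s hs
    rw [Finset.filter_filter, Finset.filter_congr fun n _ =>
      and_iff_right_of_imp fun h : g n = s => h ▸ hs]
    rcases hg s with h | h <;> omega
  rw [Finset.card_eq_sum_card_fiberwise (f := g) (t := S) fun n hn => by simpa using hn, mul_comm,
    ← smul_eq_mul]
  exact Finset.card_nsmul_le_sum _ _ _ hfiber

/-- The schedule of exploration: the transmissions, ordered by timeslot and then by subgroup, send
the messages in cyclic order. -/
def roundRobin (M L τ : ℕ) [NeZero M] (t : Fin L) (s : Fin τ) : Fin M :=
  Fin.ofNat M (finProdFinEquiv (t, s))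

theorem div_le_sum_card_roundRobin {M : ℕ} [NeZero M] (L τ : ℕ) (m : Fin M) :
    L * τ / M ≤ ∑ t, #{s | roundRobin M L τ t s = m} := by
  calc L * τ / M ≤ (L * τ).count (· ≡ m [MOD M]) := by
        rw [Nat.count_modEq_card (L * τ) (Nat.pos_of_neZero M)]
        exact Nat.le_add_right _ _
    _ = ∑ i : Fin (L * τ), if Fin.ofNat M i = m then 1 else 0 := by
        rw [Nat.count_eq_card_filter_range, Finset.card_filter,
          Fin.sum_univ_eq_sum_range fun i => if Fin.ofNat M i = m then 1 else 0]
        simp only [Fin.ext_iff, Fin.val_ofNat, Nat.ModEq, Nat.mod_eq_of_lt m.isLt]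
    _ = ∑ t, #{s | roundRobin M L τ t s = m} := by
        simp only [Finset.card_filter]
        rw [← Fintype.sum_prod_type', ← finProdFinEquiv.sum_comp]
        rfl

namespace BroadcastBandit

variable {M N K τ : ℕ} {B : BroadcastBandit M N K τ} {δ : ℝ}

theorem DiscretePayoffs.mono {δ' : ℝ} (hB : B.DiscretePayoffs δ) (h : δ' ≤ δ) :
    B.DiscretePayoffs δ' := by
  obtain ⟨Δ, hΔ, hmul⟩ := hB
  exact ⟨Δ, h.trans hΔ, hmul⟩

theorem DiscretePayoffs.sum_le_of_sum_lt_add {ι : Type*} (hB : B.DiscretePayoffs δ) (hδ : 0 < δ)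
    (S : Finset ι) (x : ι → Fin K) {m m' : Fin M}
    (h : ∑ n ∈ S, B.mean (x n) m < ∑ n ∈ S, B.mean (x n) m' + δ) :
    ∑ n ∈ S, B.mean (x n) m ≤ ∑ n ∈ S, B.mean (x n) m' := by
  obtain ⟨Δ, hΔ, hmul⟩ := hB
  choose j _ hj using hmul
  have hΔ0 : 0 < Δ := hδ.trans_le hΔ
  simp only [hj, ← Finset.sum_mul, ← Nat.cast_sum] at h ⊢
  have hlt : ((∑ n ∈ S, j (x n) m : ℕ) : ℝ) < (∑ n ∈ S, j (x n) m' : ℕ) + 1 := by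
    refine lt_of_mul_lt_mul_right ?_ hΔ0.le
    linarith
  have hle : ∑ n ∈ S, j (x n) m ≤ ∑ n ∈ S, j (x n) m' := Nat.lt_succ_iff.1 (by exact_mod_cast hlt)
  gcongr

open ProbabilityTheory

variable (B)

/-- The law of the payoffs that one user would give under each context and each message. -/
noncomputable def tableLaw : Measure (Fin K → Fin M → ℝ) :=
  Measure.pi fun k => Measure.pi fun m => B.payoff k m

instance : IsProbabilityMeasure B.tableLaw := by
  have := B.payoff_prob
  unfold tableLaw
  infer_instance

instance : IsProbabilityMeasure B.law := by
  unfold law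
  infer_instance

theorem measurePreserving_eval_law (t : ℕ) :
    MeasurePreserving (fun ω : ℕ → Slot M N K τ => ω t) B.law B.slotLaw :=
  measurePreserving_eval_infinitePi (fun _ => B.slotLaw) t

theorem measurePreserving_division_law (t : ℕ) :
    MeasurePreserving (fun ω : ℕ → Slot M N K τ => (ω t).2.1) B.law B.split.toMeasure :=
  have := B.payoff_prob
  (measurePreserving_fst.comp measurePreserving_snd).comp (B.measurePreserving_eval_law t)

theorem measurePreserving_payoff_tableLaw (k : Fin K) (m : Fin M) :
    MeasurePreserving (fun r : Fin K → Fin M → ℝ => r k m) B.tableLaw (B.payoff k m) :=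
  have := B.payoff_prob
  (measurePreserving_eval (fun m => B.payoff k m) m).comp
    (measurePreserving_eval (fun k => Measure.pi fun m => B.payoff k m) k)

theorem measurePreserving_payoff_law (t : ℕ) (n : Fin N) (k : Fin K) (m : Fin M) :
    MeasurePreserving (fun ω : ℕ → Slot M N K τ => (ω t).2.2 n k m) B.law (B.payoff k m) :=
  (B.measurePreserving_payoff_tableLaw k m).comp <|
    ((measurePreserving_eval (fun _ : Fin N => B.tableLaw) n).comp
      (measurePreserving_snd.comp measurePreserving_snd)).comp (B.measurePreserving_eval_law t)

theorem ae_isBalanced (t : ℕ) : ∀ᵐ ω ∂B.law, IsBalanced (ω t).2.1 :=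
  (B.measurePreserving_division_law t).quasiMeasurePreserving.ae <|
    (ae_mem_support B.split).mono B.split_balanced

variable {B}

theorem UniformArrivals.toMeasure_eq_pi [NeZero K] (hB : B.UniformArrivals) :
    B.arrivals.toMeasure = Measure.pi fun _ => (PMF.uniformOfFintype (Fin K)).toMeasure := by
  refine Measure.ext_of_singleton fun x => ?_
  rw [Measure.pi_singleton, PMF.toMeasure_apply_singleton _ _ (measurableSet_singleton _), hB x]
  simp only [PMF.toMeasure_apply_singleton _ _ (measurableSet_singleton _),
    PMF.uniformOfFintype_apply, Fintype.card_fin, Finset.prod_const, Finset.card_univ,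
    ENNReal.inv_pow]

theorem UniformArrivals.lintegral_slotLaw_prod [NeZero K] (hB : B.UniformArrivals)
    {F : Fin τ → Fin K × (Fin K → Fin M → ℝ) → ℝ≥0∞} (hF : ∀ s, Measurable (F s)) :
    ∫⁻ z, ∏ n, F (z.2.1 n) (z.1 n, z.2.2 n) ∂B.slotLaw =
      ∫⁻ g, ∏ n, ∫⁻ k, ∫⁻ r, F (g n) (k, r) ∂B.tableLaw ∂(PMF.uniformOfFintype (Fin K)).toMeasure
        ∂B.split.toMeasure := by
  have hslot : B.slotLaw = B.arrivals.toMeasure.prod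
    (B.split.toMeasure.prod (Measure.pi fun _ => B.tableLaw)) := rfl
  have hmeas : Measurable fun z : Slot M N K τ => ∏ n, F (z.2.1 n) (z.1 n, z.2.2 n) := by
    have hF' : Measurable fun p : Fin τ × (Fin K × (Fin K → Fin M → ℝ)) => F p.1 p.2 :=
      measurable_from_prod_countable_right hF
    have hz : ∀ n, Measurable fun z : Slot M N K τ => (z.2.1 n, z.1 n, z.2.2 n) := by fun_prop
    exact Finset.measurable_prod _ fun n _ => hF'.comp (hz n)
  calc ∫⁻ z, ∏ n, F (z.2.1 n) (z.1 n, z.2.2 n) ∂B.slotLaw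
      = ∫⁻ x, ∫⁻ g, ∫⁻ r, ∏ n, F (g n) (x n, r n) ∂(Measure.pi fun _ => B.tableLaw)
          ∂B.split.toMeasure ∂B.arrivals.toMeasure := by
        rw [hslot, lintegral_prod _ hmeas.aemeasurable]
        refine lintegral_congr fun x => ?_
        exact lintegral_prod _ (hmeas.comp measurable_prodMk_left).aemeasurable
    _ = ∫⁻ x, ∫⁻ g, ∏ n, ∫⁻ r, F (g n) (x n, r) ∂B.tableLaw
          ∂B.split.toMeasure ∂B.arrivals.toMeasure := by
        refine lintegral_congr fun x => lintegral_congr fun g => ?_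
        exact lintegral_pi_prod (fun _ : Fin N => B.tableLaw) fun n =>
          (hF (g n)).comp measurable_prodMk_left
    _ = ∫⁻ g, ∫⁻ x, ∏ n, ∫⁻ r, F (g n) (x n, r) ∂B.tableLaw
          ∂B.arrivals.toMeasure ∂B.split.toMeasure :=
        lintegral_lintegral_swap (measurable_of_finite _).aemeasurable
    _ = _ := by
        rw [hB.toMeasure_eq_pi]
        refine lintegral_congr fun g => ?_
        exact lintegral_pi_prod (fun _ : Fin N => (PMF.uniformOfFintype (Fin K)).toMeasure)
          fun n => measurable_of_finite fun k => ∫⁻ r, F (g n) (k, r) ∂B.tableLaw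

theorem lintegral_context_ite_le [NeZero K] (B : BroadcastBandit M N K τ) {φ : ℝ → ℝ≥0∞}
    (hφ : Measurable φ) {k : Fin K} {m : Fin M} {y : ℝ} (hy : y ≤ 1)
    (hint : ∫⁻ r, φ r ∂B.payoff k m ≤ ENNReal.ofReal (1 - y)) :
    ∫⁻ j, ∫⁻ r, (if j = k then φ (r k m) else 1) ∂B.tableLaw
        ∂(PMF.uniformOfFintype (Fin K)).toMeasure ≤ ENNReal.ofReal (Real.exp (-(y / K))) := by
  set U := (PMF.uniformOfFintype (Fin K)).toMeasure
  have hmass : U.real {k} = (K : ℝ)⁻¹ := by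
    simp [U, Measure.real, PMF.toMeasure_apply_singleton _ _ (measurableSet_singleton _)]
  calc ∫⁻ j, ∫⁻ r, (if j = k then φ (r k m) else 1) ∂B.tableLaw ∂U
      ≤ ∫⁻ j, (if j ∈ ({k} : Set (Fin K)) then ENNReal.ofReal (1 - y) else 1) ∂U := by
        refine lintegral_mono fun j => ?_
        simp only [Set.mem_singleton_iff]
        split_ifs with hj
        · rwa [(B.measurePreserving_payoff_tableLaw k m).lintegral_comp hφ]
        · simp
    _ ≤ ENNReal.ofReal (Real.exp (-(y * U.real {k}))) :=
        lintegral_ite_ofReal_le_exp (measurableSet_singleton k) hy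
    _ = ENNReal.ofReal (Real.exp (-(y / K))) := by rw [hmass, div_eq_mul_inv]

theorem UniformArrivals.lintegral_slotLaw_prod_ite_le [NeZero K] (hB : B.UniformArrivals)
    {φ : ℝ → ℝ≥0∞} (hφ : Measurable φ) {k : Fin K} {m : Fin M} {y : ℝ} (hy0 : 0 ≤ y) (hy : y ≤ 1)
    (hint : ∫⁻ r, φ r ∂B.payoff k m ≤ ENNReal.ofReal (1 - y)) (a : Fin τ → Fin M) :
    ∫⁻ z, ∏ n, (if z.1 n = k ∧ a (z.2.1 n) = m then φ (z.2.2 n k m) else 1) ∂B.slotLaw ≤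
      ENNReal.ofReal (Real.exp (-(y / K * ((N / τ : ℕ) * #{s | a s = m})))) := by
  have hfactor : ∀ s, ∫⁻ j, ∫⁻ r, (if j = k ∧ a s = m then φ (r k m) else 1) ∂B.tableLaw
      ∂(PMF.uniformOfFintype (Fin K)).toMeasure ≤
        ENNReal.ofReal (Real.exp (-(y / K * if a s = m then 1 else 0))) := by
    intro s
    by_cases hs : a s = m
    · simpa only [hs, and_true, if_true, mul_one] using B.lintegral_context_ite_le hφ hy hint
    · simp [hs]
  rw [hB.lintegral_slotLaw_prod
    (F := fun s p => if p.1 = k ∧ a s = m then φ (p.2 k m) else 1) fun s =>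
      Measurable.ite (measurable_fst (Set.toFinite {j | j = k ∧ a s = m}).measurableSet)
        (by fun_prop) measurable_const]
  calc _ ≤ ∫⁻ _, ENNReal.ofReal (Real.exp (-(y / K * ((N / τ : ℕ) * #{s | a s = m}))))
          ∂B.split.toMeasure := by
        refine lintegral_mono_ae ?_
        filter_upwards [ae_mem_support B.split] with g hg
        refine (Finset.prod_le_prod' fun n _ => hfactor (g n)).trans ?_
        rw [← ENNReal.ofReal_prod_of_nonneg fun n _ => (Real.exp_pos _).le, ← Real.exp_sum,
          Finset.sum_neg_distrib, ← Finset.mul_sum, Finset.sum_boole]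
        have hcard := (B.split_balanced g hg).mul_card_le {s | a s = m}
        simp only [Finset.mem_filter_univ] at hcard
        gcongr
        exact_mod_cast hcard
    _ = _ := by simp

theorem lintegral_law_prod (B : BroadcastBandit M N K τ) {L : ℕ} {f : Fin L → Slot M N K τ → ℝ≥0∞}
    (hf : ∀ i, Measurable (f i)) :
    ∫⁻ ω, ∏ i, f i (ω i) ∂B.law = ∏ i, ∫⁻ z, f i z ∂B.slotLaw := by
  have hindep : iIndepFun (fun (i : Fin L) (ω : ℕ → Slot M N K τ) => f i (ω i)) B.law :=
    ((iIndepFun_infinitePi (P := fun _ : ℕ => B.slotLaw) (X := fun _ z => z)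
      fun _ => measurable_id).precomp Fin.val_injective).comp f hf
  rw [lintegral_prod_eq_prod_lintegral_of_indepFun Finset.univ _ hindep
    fun i => (hf i).comp (measurable_pi_apply _)]
  exact Finset.prod_congr rfl fun i _ =>
    (B.measurePreserving_eval_law i).lintegral_comp (hf i)

end BroadcastBandit

namespace Strategy

variable {M N K τ L : ℕ}

theorem history_apply (π : Strategy M N K τ) (ω : ℕ → Slot M N K τ) (t : ℕ) (i : Fin t) :
    π.history ω t i = observe (ω i) (π.message ω i) := by
  induction t with
  | zero => exact i.elim0
  | succ t ih =>
    refine Fin.lastCases ?_ (fun i => ?_) i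
    · simp only [history, Fin.snoc_last, Fin.val_last]
      rfl
    · simp only [history, Fin.snoc_castSucc, Fin.val_castSucc]
      exact ih i

theorem history_congr (π : Strategy M N K τ) {ω ω' : ℕ → Slot M N K τ} {t : ℕ}
    (h : ∀ i < t, ω i = ω' i) : π.history ω t = π.history ω' t := by
  induction t with
  | zero => rfl
  | succ t ih =>
    simp only [history]
    rw [ih fun i hi => h i (by omega), h t (by omega)]

/-- The observations of the first `L` timeslots when the messages follow the fixed schedule `a`. -/
def explore (a : Fin L → Fin τ → Fin M) (ω : ℕ → Slot M N K τ) (i : Fin L) :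
    Observation M N K τ :=
  observe (ω i) (a i)

theorem measurable_explore (a : Fin L → Fin τ → Fin M) :
    Measurable (explore a : (ℕ → Slot M N K τ) → Fin L → Observation M N K τ) :=
  measurable_pi_iff.2 fun i => measurable_observe.comp
    (by fun_prop : Measurable fun ω : ℕ → Slot M N K τ => (ω i, a i))

/-- The strategy that follows the schedule `a` for `L` timeslots, and from then on decides by the
rule `c` from the observations of those `L` timeslots alone. -/
def exploreThenCommit (a : Fin L → Fin τ → Fin M)
    (c : (Fin L → Observation M N K τ) → (Fin N → Fin K) → (Fin N → Fin τ) → Fin τ → Fin M)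
    (hc : Measurable fun p : (Fin L → Observation M N K τ) × (Fin N → Fin K) × (Fin N → Fin τ) =>
      c p.1 p.2.1 p.2.2) : Strategy M N K τ where
  choose t h x g := if ht : t < L then a ⟨t, ht⟩ else c (fun i => h (i.castLE (not_lt.1 ht))) x g
  measurable_choose t := by
    by_cases ht : t < L
    · simp only [dif_pos ht, measurable_const]
    · simp only [dif_neg ht]
      exact hc.comp (Measurable.prodMk (by fun_prop) measurable_snd)

section ExploreThenCommit

variable {a : Fin L → Fin τ → Fin M}
  {c : (Fin L → Observation M N K τ) → (Fin N → Fin K) → (Fin N → Fin τ) → Fin τ → Fin M}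
  {hc : Measurable fun p : (Fin L → Observation M N K τ) × (Fin N → Fin K) × (Fin N → Fin τ) =>
    c p.1 p.2.1 p.2.2}

theorem message_exploreThenCommit_of_lt (ω : ℕ → Slot M N K τ) {t : ℕ} (ht : t < L) :
    (exploreThenCommit a c hc).message ω t = a ⟨t, ht⟩ :=
  dif_pos ht

theorem message_exploreThenCommit_of_le (ω : ℕ → Slot M N K τ) {t : ℕ} (ht : L ≤ t) :
    (exploreThenCommit a c hc).message ω t = c (explore a ω) (ω t).1 (ω t).2.1 := by
  have hhist : (fun i : Fin L => (exploreThenCommit a c hc).history ω t (i.castLE ht)) =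
      explore a ω := by
    funext i
    rw [history_apply]
    exact congrArg (observe (ω i)) (message_exploreThenCommit_of_lt ω i.isLt)
  rw [← hhist]
  exact dif_neg ht.not_gt

end ExploreThenCommit

/-- The pairs of a timeslot and a user with context `k` who was served message `m`. -/
def served (h : Fin L → Observation M N K τ) (k : Fin K) (m : Fin M) : Finset (Fin L × Fin N) :=
  {p | (h p.1).1 p.2 = k ∧ (h p.1).2.2.1 ((h p.1).2.1 p.2) = m}

theorem ofReal_exp_sum_served (a : Fin L → Fin τ → Fin M) (ω : ℕ → Slot M N K τ) (k : Fin K)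
    (m : Fin M) (c : ℝ → ℝ) :
    ENNReal.ofReal (Real.exp (∑ p ∈ served (explore a ω) k m, c ((explore a ω p.1).2.2.2 p.2))) =
      ∏ i : Fin L, ∏ n, if (ω i).1 n = k ∧ a i ((ω i).2.1 n) = m then
        ENNReal.ofReal (Real.exp (c ((ω i).2.2 n k m))) else 1 := by
  rw [Real.exp_sum, ENNReal.ofReal_prod_of_nonneg fun _ _ => (Real.exp_pos _).le, served,
    Finset.prod_filter, Fintype.prod_prod_type]
  refine Finset.prod_congr rfl fun i _ => Finset.prod_congr rfl fun n _ => ?_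
  refine if_ctx_congr Iff.rfl (fun hn => ?_) fun _ => rfl
  have hpay : (explore a ω i).2.2.2 n = (ω i).2.2 n k m := by
    rw [← hn.1, ← hn.2]
    rfl
  rw [hpay]

/-- The average payoff of the users with context `k` who were served message `m`; it is `0` if there
are no such users. -/
noncomputable def empiricalMean (h : Fin L → Observation M N K τ) (k : Fin K) (m : Fin M) : ℝ :=
  (∑ p ∈ served h k m, (h p.1).2.2.2 p.2) / #(served h k m)

theorem measurable_empiricalMean (k : Fin K) (m : Fin M) :
    Measurable fun h : Fin L → Observation M N K τ => empiricalMean h k m := by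
  have hserved : ∀ p : Fin L × Fin N, MeasurableSet {h : Fin L → Observation M N K τ |
      (h p.1).1 p.2 = k ∧ (h p.1).2.2.1 ((h p.1).2.1 p.2) = m} := fun p =>
    (Set.toFinite {q : (Fin N → Fin K) × (Fin N → Fin τ) × (Fin τ → Fin M) |
      q.1 p.2 = k ∧ q.2.2 (q.2.1 p.2) = m}).measurableSet.preimage
      (by fun_prop : Measurable fun h : Fin L → Observation M N K τ =>
        ((h p.1).1, (h p.1).2.1, (h p.1).2.2.1))
  simp only [empiricalMean, served, Finset.sum_filter, Finset.card_filter, Nat.cast_sum]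
  exact (Finset.measurable_sum _ fun p _ =>
    Measurable.ite (hserved p) (by fun_prop) measurable_const).div <|
    Finset.measurable_sum _ fun p _ => measurable_from_nat.comp <|
      Measurable.ite (hserved p) measurable_const measurable_const

/-- The decision rule that sends to every subgroup a message with the largest total empirical mean
over the contexts of that subgroup. -/
noncomputable def greedy [NeZero M] (h : Fin L → Observation M N K τ) (x : Fin N → Fin K)
    (g : Fin N → Fin τ) (s : Fin τ) : Fin M :=
  argmax fun m => ∑ n with g n = s, empiricalMean h (x n) m

theorem measurable_greedy [NeZero M] :
    Measurable fun p : (Fin L → Observation M N K τ) × (Fin N → Fin K) × (Fin N → Fin τ) =>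
      greedy p.1 p.2.1 p.2.2 := by
  refine measurable_from_prod_countable_left fun q => measurable_pi_iff.2 fun s => ?_
  have hscore : Measurable fun (h : Fin L → Observation M N K τ) (m : Fin M) =>
      ∑ n with q.2 n = s, empiricalMean h (q.1 n) m :=
    measurable_pi_iff.2 fun m => Finset.measurable_sum _ fun n _ => measurable_empiricalMean _ m
  exact measurable_argmax.comp hscore

end Strategy

namespace BroadcastBandit

open Strategy

variable {M N K τ L : ℕ} (B : BroadcastBandit M N K τ)

/-- The observations after which the empirical mean of message `m` for context `k` misses `μ(k, m)`
by at least `ε`. -/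
def misestimated (L : ℕ) (ε : ℝ) (k : Fin K) (m : Fin M) : Set (Fin L → Observation M N K τ) :=
  {h | ε ≤ |empiricalMean h k m - B.mean k m|}

theorem measurableSet_misestimated (ε : ℝ) (k : Fin K) (m : Fin M) :
    MeasurableSet (B.misestimated L ε k m) :=
  measurableSet_le measurable_const
    (continuous_abs.measurable.comp ((measurable_empiricalMean k m).sub_const _))

theorem exists_sign_of_mem_misestimated {ε : ℝ} {k : Fin K} {m : Fin M}
    {h : Fin L → Observation M N K τ} (hh : h ∈ B.misestimated L ε k m) :
    ∃ σ : ℝ, (σ = 1 ∨ σ = -1) ∧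
      0 ≤ ∑ p ∈ served h k m, (σ * ((h p.1).2.2.2 p.2 - B.mean k m) - ε) := by
  have hsum : ∀ σ : ℝ, ∑ p ∈ served h k m, (σ * ((h p.1).2.2.2 p.2 - B.mean k m) - ε) =
      #(served h k m) * (σ * (empiricalMean h k m - B.mean k m) - ε) := by
    intro σ
    rcases (served h k m).eq_empty_or_nonempty with hS | hS
    · simp [hS]
    · have hcard : (#(served h k m) : ℝ) ≠ 0 := by exact_mod_cast hS.card_ne_zero
      simp only [empiricalMean, Finset.sum_sub_distrib, ← Finset.mul_sum, Finset.sum_const,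
        nsmul_eq_mul]
      field_simp
  have habs : ε ≤ |empiricalMean h k m - B.mean k m| := hh
  rcases le_abs.1 habs with hσ | hσ
  · exact ⟨1, .inl rfl, by rw [hsum]; exact mul_nonneg (Nat.cast_nonneg _) (by linarith)⟩
  · exact ⟨-1, .inr rfl, by rw [hsum]; exact mul_nonneg (Nat.cast_nonneg _) (by linarith)⟩

variable {B}

theorem UniformArrivals.measure_sum_served_nonneg_le [NeZero K] (hB : B.UniformArrivals)
    (a : Fin L → Fin τ → Fin M) (k : Fin K) (m : Fin M) {ε σ : ℝ} (hε0 : 0 ≤ ε)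
    (hε : ε ^ 2 ≤ 1 / 2) (hσ : σ ^ 2 = 1) :
    B.law {ω | 0 ≤ ∑ p ∈ served (explore a ω) k m,
        (σ * ((explore a ω p.1).2.2.2 p.2 - B.mean k m) - ε)} ≤
      ENNReal.ofReal (Real.exp (-(ε ^ 2 / K * ((N / τ : ℕ) * ∑ i, #{s | a i s = m})))) := by
  have := B.payoff_prob
  let φ : ℝ → ℝ≥0∞ := fun r => ENNReal.ofReal (Real.exp (4 * ε * (σ * (r - B.mean k m) - ε)))
  let F : Fin L → Slot M N K τ → ℝ≥0∞ := fun i z =>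
    ∏ n, if z.1 n = k ∧ a i (z.2.1 n) = m then φ (z.2.2 n k m) else 1
  have hφ : Measurable φ := by fun_prop
  have hF : ∀ i, Measurable (F i) := fun i => Finset.measurable_prod _ fun n _ =>
    Measurable.ite ((Set.toFinite {q : (Fin N → Fin K) × (Fin N → Fin τ) |
      q.1 n = k ∧ a i (q.2 n) = m}).measurableSet.preimage (by fun_prop : Measurable
        fun z : Slot M N K τ => (z.1, z.2.1))) (by fun_prop) measurable_const
  have hint : ∫⁻ r, φ r ∂B.payoff k m ≤ ENNReal.ofReal (1 - ε ^ 2) :=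
    (lintegral_exp_deviation_le (B.payoff k m) (B.payoff_mem k m) ε hσ).trans <|
      ENNReal.ofReal_le_ofReal (exp_neg_two_mul_le_one_sub (sq_nonneg ε) hε)
  have hexp : ∀ ω, ENNReal.ofReal (Real.exp (4 * ε * ∑ p ∈ served (explore a ω) k m,
      (σ * ((explore a ω p.1).2.2.2 p.2 - B.mean k m) - ε))) = ∏ i, F i (ω i) := fun ω => by
    rw [Finset.mul_sum]
    exact ofReal_exp_sum_served a ω k m fun r => 4 * ε * (σ * (r - B.mean k m) - ε)
  calc _ ≤ B.law {ω | 1 ≤ ∏ i, F i (ω i)} := by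
        refine measure_mono fun ω hω => ?_
        simp only [Set.mem_ofPred_eq] at hω ⊢
        rw [← hexp ω, ENNReal.one_le_ofReal, Real.one_le_exp_iff]
        positivity
    _ ≤ ∫⁻ ω, ∏ i, F i (ω i) ∂B.law := by
        simpa using mul_meas_ge_le_lintegral (μ := B.law) (f := fun ω => ∏ i, F i (ω i))
          (Finset.measurable_prod _ fun i _ => (hF i).comp (measurable_pi_apply _)) 1
    _ = ∏ i, ∫⁻ z, F i z ∂B.slotLaw := B.lintegral_law_prod hF
    _ ≤ ∏ i, ENNReal.ofReal (Real.exp (-(ε ^ 2 / K * ((N / τ : ℕ) * #{s | a i s = m})))) :=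
        Finset.prod_le_prod' fun i _ =>
          hB.lintegral_slotLaw_prod_ite_le hφ (sq_nonneg ε) (by linarith) hint (a i)
    _ = _ := by
        rw [← ENNReal.ofReal_prod_of_nonneg fun _ _ => (Real.exp_pos _).le, ← Real.exp_sum,
          Finset.sum_neg_distrib, ← Finset.mul_sum, ← Finset.mul_sum, Nat.cast_sum]

theorem UniformArrivals.measureReal_misestimated_le [NeZero K] (hB : B.UniformArrivals)
    (a : Fin L → Fin τ → Fin M) (k : Fin K) (m : Fin M) {ε : ℝ} (hε0 : 0 ≤ ε)
    (hε : ε ^ 2 ≤ 1 / 2) :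
    B.law.real {ω | explore a ω ∈ B.misestimated L ε k m} ≤
      2 * Real.exp (-(ε ^ 2 / K * ((N / τ : ℕ) * ∑ i, #{s | a i s = m}))) := by
  set p := Real.exp (-(ε ^ 2 / K * ((N / τ : ℕ) * ∑ i, #{s | a i s = m})))
  let D : ℝ → Set (ℕ → Slot M N K τ) := fun σ => {ω | 0 ≤ ∑ p ∈ served (explore a ω) k m,
    (σ * ((explore a ω p.1).2.2.2 p.2 - B.mean k m) - ε)}
  have hD : ∀ σ : ℝ, σ ^ 2 = 1 → B.law.real (D σ) ≤ p := fun σ hσ =>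
    ENNReal.toReal_le_of_le_ofReal (Real.exp_pos _).le
      (hB.measure_sum_served_nonneg_le a k m hε0 hε hσ)
  have hsub : {ω | explore a ω ∈ B.misestimated L ε k m} ⊆ D 1 ∪ D (-1) := by
    intro ω hω
    obtain ⟨σ, rfl | rfl, h⟩ := B.exists_sign_of_mem_misestimated hω
    exacts [.inl h, .inr h]
  calc _ ≤ B.law.real (D 1 ∪ D (-1)) := measureReal_mono hsub
    _ ≤ B.law.real (D 1) + B.law.real (D (-1)) := measureReal_union_le _ _
    _ ≤ 2 * p := by linarith [hD 1 (by norm_num), hD (-1) (by norm_num)]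

end BroadcastBandit

theorem indepFun_eval_infinitePi_of_dependsOn {ι α : Type*} {E : ι → Type*}
    [∀ i, MeasurableSpace (E i)] [MeasurableSpace α] (ν : ∀ i, Measure (E i))
    [∀ i, IsProbabilityMeasure (ν i)] {X : (∀ i, E i) → α} (hX : Measurable X) {s : Finset ι}
    (hs : DependsOn X (s : Set ι)) {t : ι} (ht : t ∉ s) :
    ProbabilityTheory.IndepFun X (fun ω => ω t) (Measure.infinitePi ν) := by
  classical
  obtain ⟨z⟩ : Nonempty (∀ i, E i) := ⟨fun i => (nonempty_of_isProbabilityMeasure (ν i)).some⟩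
  have hindep := (ProbabilityTheory.iIndepFun_infinitePi (P := ν) (X := fun _ z => z)
    fun _ => measurable_id).indepFun_finset s {t} (by simpa using ht) fun i => measurable_pi_apply i
  have hrestrict : X = (X ∘ Function.updateFinset z s) ∘ fun (ω : ∀ i, E i) (i : s) => ω i := by
    funext ω
    exact hs fun i (hi : i ∈ s) => by simp [Function.updateFinset, hi]
  rw [hrestrict]
  exact hindep.comp (hX.comp measurable_updateFinset)
    (measurable_pi_apply (⟨t, Finset.mem_singleton_self t⟩ : ({t} : Finset ι)))

namespace BroadcastBandit

open Strategy ProbabilityTheory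

variable {M N K τ L : ℕ} (B : BroadcastBandit M N K τ)

theorem indepFun_history (π : Strategy M N K τ) (t : ℕ) :
    IndepFun (fun ω => π.history ω t) (fun ω => ω t) B.law :=
  indepFun_eval_infinitePi_of_dependsOn _ (π.measurable_history t) (s := Finset.range t)
    (fun _ _ h => π.history_congr fun i hi => h i (by simpa using hi)) (by simp)

theorem indepFun_explore (a : Fin L → Fin τ → Fin M) {t : ℕ} (ht : L ≤ t) :
    IndepFun (explore a) (fun ω => ω t) B.law :=
  indepFun_eval_infinitePi_of_dependsOn _ (measurable_explore a) (s := Finset.range L)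
    (fun _ _ h => funext fun i => congrArg (observe · (a i)) (h i (by simp))) (by simpa using ht)

theorem indepFun_decision_payoff (π : Strategy M N K τ) (t : ℕ) :
    IndepFun (fun ω => ((π.history ω t, (ω t).1), (ω t).2.1)) (fun ω => (ω t).2.2) B.law := by
  have := B.payoff_prob
  have heval := B.measurePreserving_eval_law t
  have hcontext : IndepFun (fun ω : ℕ → Slot M N K τ => (ω t).1) (fun ω => (ω t).2) B.law :=
    indepFun_comp_measurePreserving heval measurable_fst measurable_snd
      (indepFun_prod measurable_id measurable_id)
  have hdivision : IndepFun (fun ω : ℕ → Slot M N K τ => (ω t).2.1) (fun ω => (ω t).2.2) B.law :=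
    indepFun_comp_measurePreserving (measurePreserving_snd.comp heval) measurable_fst
      measurable_snd (indepFun_prod measurable_id measurable_id)
  have hhistory := π.measurable_history t
  exact indepFun_prodMk_left (hhistory.prodMk (by fun_prop)) (by fun_prop) (by fun_prop)
    (indepFun_prodMk_left hhistory (by fun_prop) (by fun_prop) (B.indepFun_history π t) hcontext)
    hdivision

theorem integrable_payoff_law (t : ℕ) (n : Fin N) (k : Fin K) (m : Fin M) :
    Integrable (fun ω : ℕ → Slot M N K τ => (ω t).2.2 n k m) B.law :=
  Integrable.of_mem_Icc 0 1 (B.measurePreserving_payoff_law t n k m).measurable.aemeasurable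
    ((B.ae_payoff_mem t).mono fun _ h => h n k m)

theorem integral_payoff_law (t : ℕ) (n : Fin N) (k : Fin K) (m : Fin M) :
    ∫ ω : ℕ → Slot M N K τ, (ω t).2.2 n k m ∂B.law = B.mean k m := by
  have hlaw := B.measurePreserving_payoff_law t n k m
  rw [mean, ← hlaw.map_eq]
  exact (integral_map hlaw.measurable.aemeasurable aestronglyMeasurable_id).symm

theorem measurable_context_message (π : Strategy M N K τ) (t : ℕ) (n : Fin N) :
    Measurable fun ω : ℕ → Slot M N K τ => ((ω t).1 n, π.message ω t ((ω t).2.1 n)) := by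
  have hserve : Measurable fun q : (Fin N → Fin τ) × (Fin τ → Fin M) => q.2 (q.1 n) :=
    measurable_of_finite _
  have hg : Measurable fun ω : ℕ → Slot M N K τ => (ω t).2.1 := by fun_prop
  exact Measurable.prodMk (by fun_prop) (hserve.comp (hg.prodMk (π.measurable_message t)))

theorem integrable_payoff_message (π : Strategy M N K τ) (t : ℕ) (n : Fin N) :
    Integrable (fun ω => (ω t).2.2 n ((ω t).1 n) (π.message ω t ((ω t).2.1 n))) B.law :=
  integrable_apply_of_finite (Y := fun p : Fin K × Fin M => fun ω => (ω t).2.2 n p.1 p.2)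
    (measurable_context_message π t n) fun p => B.integrable_payoff_law t n p.1 p.2

theorem integral_payoff_message (π : Strategy M N K τ) (t : ℕ) (n : Fin N) :
    ∫ ω, (ω t).2.2 n ((ω t).1 n) (π.message ω t ((ω t).2.1 n)) ∂B.law =
      ∫ ω, B.mean ((ω t).1 n) (π.message ω t ((ω t).2.1 n)) ∂B.law := by
  have hserve : Measurable fun q : (Fin N → Fin K) × (Fin N → Fin τ) × (Fin τ → Fin M) =>
      (q.1 n, q.2.2 (q.2.1 n)) := measurable_of_finite _
  have hdecide : Measurable
      fun q : ((Fin t → Observation M N K τ) × (Fin N → Fin K)) × (Fin N → Fin τ) =>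
        (q.1.2 n, π.choose t q.1.1 q.1.2 q.2 (q.2 n)) :=
    hserve.comp (Measurable.prodMk (by fun_prop) (Measurable.prodMk (by fun_prop)
      ((π.measurable_choose t).comp MeasurableEquiv.prodAssoc.measurable)))
  have hindep : ∀ p : Fin K × Fin M, IndepFun
      (fun ω => ((ω t).1 n, π.message ω t ((ω t).2.1 n))) (fun ω => (ω t).2.2 n p.1 p.2) B.law :=
    fun p => (B.indepFun_decision_payoff π t).comp hdecide (by fun_prop : Measurable
      fun r : Fin N → Fin K → Fin M → ℝ => r n p.1 p.2)
  refine (integral_apply_eq_of_indepFun (measurable_context_message π t n)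
    (fun p => B.integrable_payoff_law t n p.1 p.2) hindep).trans ?_
  simp only [integral_payoff_law]

theorem mean_mem_Icc (k : Fin K) (m : Fin M) : B.mean k m ∈ Set.Icc (0 : ℝ) 1 := by
  have := B.payoff_prob k m
  have hint : Integrable (fun r => r) (B.payoff k m) :=
    Integrable.of_mem_Icc 0 1 measurable_id.aemeasurable (B.payoff_mem k m)
  exact (convex_Icc 0 1).integral_mem isClosed_Icc (B.payoff_mem k m) hint

/-- The expected payoff that is lost against `best` when message `b s` is sent to subgroup `s`. -/
noncomputable def gap (x : Fin N → Fin K) (g : Fin N → Fin τ) (b : Fin τ → Fin M) : ℝ :=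
  B.best x g - ∑ n, B.mean (x n) (b (g n))

theorem integrable_gap {b : (ℕ → Slot M N K τ) → Fin τ → Fin M} (hb : Measurable b) (t : ℕ) :
    Integrable (fun ω => B.gap (ω t).1 (ω t).2.1 (b ω)) B.law :=
  have hslot : Measurable fun ω : ℕ → Slot M N K τ => ((ω t).1, (ω t).2.1, b ω) := by fun_prop
  integrable_comp_of_finite hslot fun q => B.gap q.1 q.2.1 q.2.2

theorem regret_eq_sum_integral_gap (π : Strategy M N K τ) (T : ℕ) :
    B.regret π T =
      ∑ t ∈ Finset.range T, ∫ ω, B.gap (ω t).1 (ω t).2.1 (π.message ω t) ∂B.law := by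
  have hbest : ∀ t, Integrable (fun ω => B.best (ω t).1 (ω t).2.1) B.law := fun t =>
    integrable_comp_of_finite (by fun_prop : Measurable
      fun ω : ℕ → Slot M N K τ => ((ω t).1, (ω t).2.1)) fun q => B.best q.1 q.2
  have hpay : ∀ t, Integrable
      (fun ω => ∑ n, (ω t).2.2 n ((ω t).1 n) (π.message ω t ((ω t).2.1 n))) B.law := fun t =>
    integrable_finsetSum _ fun n _ => B.integrable_payoff_message π t n
  have hmean : ∀ t n, Integrable
      (fun ω => B.mean ((ω t).1 n) (π.message ω t ((ω t).2.1 n))) B.law := fun t n =>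
    integrable_comp_of_finite (measurable_context_message π t n) fun p => B.mean p.1 p.2
  unfold regret pathRegret
  refine (integral_finsetSum _ fun t _ => (hbest t).sub (hpay t)).trans ?_
  refine Finset.sum_congr rfl fun t _ => ?_
  unfold gap
  refine (integral_sub (hbest t) (hpay t)).trans ?_
  rw [integral_sub (hbest t) (integrable_finsetSum _ fun n _ => hmean t n),
    integral_finsetSum _ fun n _ => B.integrable_payoff_message π t n,
    integral_finsetSum _ fun n _ => hmean t n]
  simp only [integral_payoff_message]

theorem iSup_sum_mean_le_card (S : Finset (Fin N)) (x : Fin N → Fin K) :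
    ⨆ m, ∑ n ∈ S, B.mean (x n) m ≤ #S := by
  refine Real.iSup_le (fun m => ?_) (Nat.cast_nonneg _)
  simpa using Finset.sum_le_card_nsmul S _ 1 fun n _ => (B.mean_mem_Icc (x n) m).2

theorem gap_le (x : Fin N → Fin K) (g : Fin N → Fin τ) (b : Fin τ → Fin M) :
    B.gap x g b ≤ N := by
  have hbest : B.best x g ≤ N := by
    calc B.best x g ≤ ∑ s, (#{n | g n = s} : ℝ) :=
          Finset.sum_le_sum fun s _ => B.iSup_sum_mean_le_card _ x
      _ = N := by
          rw [← Nat.cast_sum, ← Finset.card_eq_sum_card_fiberwise (f := g) (by simp),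
            Finset.card_univ, Fintype.card_fin]
  have hmean : 0 ≤ ∑ n, B.mean (x n) (b (g n)) :=
    Finset.sum_nonneg fun n _ => (B.mean_mem_Icc _ _).1
  unfold gap
  linarith

theorem regret_le_of_forall_integral_gap_le (π : Strategy M N K τ) {P : ℝ} (hP : 0 ≤ P)
    (h : ∀ t, L ≤ t → ∫ ω, B.gap (ω t).1 (ω t).2.1 (π.message ω t) ∂B.law ≤ P) (T : ℕ) :
    B.regret π T ≤ L * N + T * P := by
  rw [regret_eq_sum_integral_gap]
  calc _ ≤ ∑ t ∈ Finset.range T, ((if t < L then (N : ℝ) else 0) + P) := by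
        refine Finset.sum_le_sum fun t _ => ?_
        split_ifs with ht
        · have hN : ∫ ω, B.gap (ω t).1 (ω t).2.1 (π.message ω t) ∂B.law ≤ ∫ _, (N : ℝ) ∂B.law :=
            integral_mono (B.integrable_gap (π.measurable_message t) t) (integrable_const _)
              fun ω => B.gap_le _ _ _
          rw [integral_const, probReal_univ, one_smul] at hN
          linarith
        · linarith [h t (not_lt.1 ht)]
    _ = #{t ∈ Finset.range T | t < L} * N + T * P := by
        simp only [Finset.sum_add_distrib, ← Finset.sum_filter, Finset.sum_const,
          Finset.card_range, nsmul_eq_mul]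
    _ ≤ L * N + T * P := by
        gcongr
        simpa using Finset.card_le_card (t := Finset.range L) fun t ht => by
          simpa using (Finset.mem_filter.1 ht).2

theorem gap_eq_sum (x : Fin N → Fin K) (g : Fin N → Fin τ) (b : Fin τ → Fin M) :
    B.gap x g b = ∑ s, ((⨆ m, ∑ n with g n = s, B.mean (x n) m) -
      ∑ n with g n = s, B.mean (x n) (b s)) := by
  have hfiber : ∑ n, B.mean (x n) (b (g n)) = ∑ s, ∑ n with g n = s, B.mean (x n) (b s) := by
    rw [← Finset.sum_fiberwise Finset.univ g]
    refine Finset.sum_congr rfl fun s _ => Finset.sum_congr rfl fun n hn => ?_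
    rw [(Finset.mem_filter.1 hn).2]
  rw [gap, best, hfiber, Finset.sum_sub_distrib]

/-- The number of messages whose payoff for context `k` is misestimated after the observations `h`,
as a real number. -/
noncomputable def misestimatedCount (ε : ℝ) (h : Fin L → Observation M N K τ) (k : Fin K) : ℝ :=
  ∑ m, (B.misestimated L ε k m).indicator (fun _ => (1 : ℝ)) h

section MisestimatedCount

variable {B} {ε : ℝ}

theorem misestimatedCount_nonneg (h : Fin L → Observation M N K τ) (k : Fin K) :
    0 ≤ B.misestimatedCount ε h k :=
  Finset.sum_nonneg fun _ _ => Set.indicator_nonneg (fun _ _ => zero_le_one) h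

theorem one_le_misestimatedCount {h : Fin L → Observation M N K τ} {k : Fin K} {m : Fin M}
    (hm : h ∈ B.misestimated L ε k m) : 1 ≤ B.misestimatedCount ε h k :=
  calc (1 : ℝ) = (B.misestimated L ε k m).indicator (fun _ => (1 : ℝ)) h :=
        (Set.indicator_of_mem hm fun _ => (1 : ℝ)).symm
    _ ≤ B.misestimatedCount ε h k :=
        Finset.single_le_sum (f := fun m => (B.misestimated L ε k m).indicator _ h)
          (fun _ _ => Set.indicator_nonneg (fun _ _ => zero_le_one) h) (Finset.mem_univ m)

theorem measurable_misestimatedCount (k : Fin K) :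
    Measurable fun h : Fin L → Observation M N K τ => B.misestimatedCount ε h k :=
  Finset.measurable_sum _ fun m _ =>
    measurable_const.indicator (B.measurableSet_misestimated ε k m)

variable (a : Fin L → Fin τ → Fin M)

theorem measurableSet_explore_mem_misestimated (k : Fin K) (m : Fin M) :
    MeasurableSet {ω | explore a ω ∈ B.misestimated L ε k m} :=
  measurable_explore a (B.measurableSet_misestimated ε k m)

theorem integrable_misestimatedCount (k : Fin K) :
    Integrable (fun ω => B.misestimatedCount ε (explore a ω) k) B.law :=
  integrable_finsetSum _ fun m _ =>
    (integrable_const (1 : ℝ)).indicator (measurableSet_explore_mem_misestimated a k m)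

theorem integral_misestimatedCount (k : Fin K) :
    ∫ ω, B.misestimatedCount ε (explore a ω) k ∂B.law =
      ∑ m, B.law.real {ω | explore a ω ∈ B.misestimated L ε k m} := by
  have hset := fun m => measurableSet_explore_mem_misestimated (B := B) (ε := ε) a k m
  refine (integral_finsetSum _ fun m _ => (integrable_const (1 : ℝ)).indicator (hset m)).trans ?_
  exact Finset.sum_congr rfl fun m _ => integral_indicator_one (hset m)

theorem integral_misestimatedCount_context {t : ℕ} (ht : L ≤ t) (n : Fin N) :
    ∫ ω, B.misestimatedCount ε (explore a ω) ((ω t).1 n) ∂B.law =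
      ∫ ω, ∑ m, B.law.real {ω' | explore a ω' ∈ B.misestimated L ε ((ω t).1 n) m} ∂B.law := by
  have hindep : ∀ k, IndepFun (fun ω => (ω t).1 n)
      (fun ω => B.misestimatedCount ε (explore a ω) k) B.law := fun k =>
    ((B.indepFun_explore a ht).comp (measurable_misestimatedCount k)
      (by fun_prop : Measurable fun z : Slot M N K τ => z.1 n)).symm
  refine (integral_apply_eq_of_indepFun (by fun_prop)
    (fun k => integrable_misestimatedCount a k) hindep).trans ?_
  simp only [integral_misestimatedCount]

end MisestimatedCount

section Greedy

variable [NeZero M] {B} {δ ε : ℝ}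

theorem DiscretePayoffs.iSup_sum_mean_le_sum_mean_greedy (hB : B.DiscretePayoffs δ) (hδ : 0 < δ)
    {h : Fin L → Observation M N K τ} {x : Fin N → Fin K} {g : Fin N → Fin τ} {s : Fin τ}
    (hcard : #{n | g n = s} * ε ≤ δ / 2)
    (hacc : ∀ n, g n = s → ∀ m, h ∉ B.misestimated L ε (x n) m) :
    ⨆ m, ∑ n with g n = s, B.mean (x n) m ≤
      ∑ n with g n = s, B.mean (x n) (greedy h x g s) := by
  rcases ({n | g n = s} : Finset (Fin N)).eq_empty_or_nonempty with hS | hS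
  · simp [hS]
  have hclose : ∀ m, |∑ n with g n = s, empiricalMean h (x n) m -
      ∑ n with g n = s, B.mean (x n) m| < δ / 2 := fun m =>
    calc _ ≤ ∑ n with g n = s, |empiricalMean h (x n) m - B.mean (x n) m| := by
          rw [← Finset.sum_sub_distrib]
          exact Finset.abs_sum_le_sum_abs _ _
      _ < ∑ n with g n = s, ε := Finset.sum_lt_sum_of_nonempty hS fun n hn =>
          not_le.1 (hacc n (Finset.mem_filter.1 hn).2 m)
      _ ≤ δ / 2 := by rwa [Finset.sum_const, nsmul_eq_mul]
  exact ciSup_le fun m => hB.sum_le_of_sum_lt_add hδ _ x (lt_apply_argmax_add hclose m)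

theorem DiscretePayoffs.gap_greedy_le (hB : B.DiscretePayoffs δ) (hδ : 0 < δ) (hε : 0 ≤ ε)
    (hG : (N / τ + 1 : ℕ) * ε ≤ δ / 2) (h : Fin L → Observation M N K τ) (x : Fin N → Fin K)
    {g : Fin N → Fin τ} (hg : IsBalanced g) :
    B.gap x g (greedy h x g) ≤ (N / τ + 1 : ℕ) * ∑ n, B.misestimatedCount ε h (x n) := by
  have hcard : ∀ s, (#{n | g n = s} : ℝ) ≤ (N / τ + 1 : ℕ) := fun s => by
    exact_mod_cast hg.card_le s
  rw [gap_eq_sum, ← Finset.sum_fiberwise Finset.univ g, Finset.mul_sum]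
  refine Finset.sum_le_sum fun s _ => ?_
  by_cases hacc : ∀ n, g n = s → ∀ m, h ∉ B.misestimated L ε (x n) m
  · have hgreedy := hB.iSup_sum_mean_le_sum_mean_greedy hδ
      ((mul_le_mul_of_nonneg_right (hcard s) hε).trans hG) hacc
    exact (sub_nonpos.2 hgreedy).trans <| mul_nonneg (Nat.cast_nonneg _) <|
      Finset.sum_nonneg fun n _ => misestimatedCount_nonneg h (x n)
  · push Not at hacc
    obtain ⟨n, hn, m, hm⟩ := hacc
    have hone : 1 ≤ ∑ n with g n = s, B.misestimatedCount ε h (x n) :=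
      (one_le_misestimatedCount hm).trans <|
        Finset.single_le_sum (f := fun n => B.misestimatedCount ε h (x n))
          (fun n _ => misestimatedCount_nonneg h (x n)) (by simpa using hn)
    have hmean : 0 ≤ ∑ n with g n = s, B.mean (x n) (greedy h x g s) :=
      Finset.sum_nonneg fun n _ => (B.mean_mem_Icc _ _).1
    have hmul := le_mul_of_one_le_right (Nat.cast_nonneg (α := ℝ) (N / τ + 1)) hone
    linarith [B.iSup_sum_mean_le_card {n | g n = s} x, hcard s]

theorem DiscretePayoffs.integral_gap_greedy_le (hB : B.DiscretePayoffs δ) (hδ : 0 < δ) (hε : 0 ≤ ε)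
    (hG : (N / τ + 1 : ℕ) * ε ≤ δ / 2) (a : Fin L → Fin τ → Fin M) {P : ℝ}
    (hP : ∀ k m, B.law.real {ω | explore a ω ∈ B.misestimated L ε k m} ≤ P) {t : ℕ} (ht : L ≤ t) :
    ∫ ω, B.gap (ω t).1 (ω t).2.1 (greedy (explore a ω) (ω t).1 (ω t).2.1) ∂B.law ≤
      (N / τ + 1 : ℕ) * (N * (M * P)) := by
  have hslot : Measurable fun ω : ℕ → Slot M N K τ => (explore a ω, (ω t).1, (ω t).2.1) :=
    (measurable_explore a).prodMk (by fun_prop)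
  have hcontext : ∀ n, Measurable fun ω : ℕ → Slot M N K τ => (ω t).1 n := fun n => by fun_prop
  have hint : ∀ n, Integrable
      (fun ω => B.misestimatedCount ε (explore a ω) ((ω t).1 n)) B.law := fun n =>
    integrable_apply_of_finite (hcontext n) fun k => integrable_misestimatedCount a k
  calc _ ≤ ∫ ω, (N / τ + 1 : ℕ) *
        ∑ n, B.misestimatedCount ε (explore a ω) ((ω t).1 n) ∂B.law := by
        refine integral_mono_ae (B.integrable_gap (measurable_greedy.comp hslot) t)
          ((integrable_finsetSum _ fun n _ => hint n).const_mul _) ?_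
        filter_upwards [B.ae_isBalanced t] with ω hω
        exact hB.gap_greedy_le hδ hε hG _ _ hω
    _ = (N / τ + 1 : ℕ) *
        ∑ n, ∫ ω, ∑ m, B.law.real
          {ω' | explore a ω' ∈ B.misestimated L ε ((ω t).1 n) m} ∂B.law := by
        rw [integral_const_mul, integral_finsetSum _ fun n _ => hint n]
        simp only [integral_misestimatedCount_context a ht]
    _ ≤ (N / τ + 1 : ℕ) * ∑ _n : Fin N, ∫ _, (∑ _m : Fin M, P) ∂B.law := by
        gcongr with n
        · exact integrable_comp_of_finite (hcontext n) fun k =>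
            ∑ m, B.law.real {ω' | explore a ω' ∈ B.misestimated L ε k m}
        · exact integrable_const _
        · exact fun ω => Finset.sum_le_sum fun m _ => hP _ m
    _ = _ := by simp

theorem DiscretePayoffs.regret_exploreThenCommit_greedy_le (hB : B.DiscretePayoffs δ) (hδ : 0 < δ)
    (hε : 0 ≤ ε) (hG : (N / τ + 1 : ℕ) * ε ≤ δ / 2) (a : Fin L → Fin τ → Fin M) {P : ℝ}
    (hP0 : 0 ≤ P) (hP : ∀ k m, B.law.real {ω | explore a ω ∈ B.misestimated L ε k m} ≤ P) (T : ℕ) :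
    B.regret (exploreThenCommit a greedy measurable_greedy) T ≤
      L * N + T * ((N / τ + 1 : ℕ) * (N * (M * P))) := by
  refine B.regret_le_of_forall_integral_gap_le _ (by positivity) (fun t ht => ?_) T
  simp only [message_exploreThenCommit_of_le _ ht]
  exact hB.integral_gap_greedy_le hδ hε hG a hP ht

end Greedy

end BroadcastBandit

theorem exists_le_div_and_le {M τ : ℕ} (hM : 0 < M) (hτ : 0 < τ) {y : ℝ} (hy : 0 ≤ y) :
    ∃ L : ℕ, y ≤ (L * τ / M : ℕ) ∧ (L : ℝ) ≤ M * (y + 1) / τ + 1 := by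
  have hτ' : (0 : ℝ) < τ := by exact_mod_cast hτ
  refine ⟨⌈(M * ⌈y⌉₊ : ℝ) / τ⌉₊, (Nat.le_ceil y).trans ?_, ?_⟩
  · rw [Nat.cast_le, Nat.le_div_iff_mul_le hM, mul_comm]
    have hceil := (div_le_iff₀ hτ').1 (Nat.le_ceil ((M * ⌈y⌉₊ : ℝ) / τ))
    exact_mod_cast hceil
  · refine (Nat.ceil_lt_add_one (by positivity)).le.trans ?_
    gcongr
    exact (Nat.ceil_lt_add_one hy).le

theorem exists_accuracy {δ : ℝ} (hδ : 0 < δ) (hδ1 : δ ≤ 1) {f : ℕ} (hf : 1 ≤ f) :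
    ∃ ε : ℝ, 0 < ε ∧ ε ^ 2 ≤ 1 / 2 ∧ (f + 1 : ℕ) * ε ≤ δ / 2 ∧
      1 / (ε ^ 2 * f) ≤ 16 / δ ^ 2 * f := by
  have hf' : (1 : ℝ) ≤ f := by exact_mod_cast hf
  have hG : ((f + 1 : ℕ) : ℝ) ≤ 2 * f := by push_cast; linarith
  have hε1 : δ / (2 * (f + 1 : ℕ)) ≤ 1 / 2 := by
    rw [div_le_div_iff₀ (by positivity) two_pos]
    push_cast
    linarith
  refine ⟨δ / (2 * (f + 1 : ℕ)), by positivity, ?_, ?_, ?_⟩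
  · nlinarith [show 0 < δ / (2 * (f + 1 : ℕ)) by positivity]
  · field_simp
    exact le_rfl
  · calc 1 / ((δ / (2 * (f + 1 : ℕ))) ^ 2 * f) = 4 / (δ ^ 2 * f) * ((f + 1 : ℕ) : ℝ) ^ 2 := by
          field_simp
          norm_num
      _ ≤ 4 / (δ ^ 2 * f) * (2 * f) ^ 2 := by gcongr
      _ = 16 / δ ^ 2 * f := by field_simp; norm_num

theorem half_le_log {x : ℝ} (hx : 2 ≤ x) : 1 / 2 ≤ Real.log x := by
  linarith [Real.log_le_log two_pos hx, Real.log_two_gt_d9]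

theorem mul_mul_exp_neg_two_mul_log_le_one {x y z : ℝ} (hx : 0 < x) (hyx : y ≤ x) (hz : 0 ≤ z)
    (hzx : z ≤ x) : y * z * Real.exp (-(2 * Real.log x)) ≤ 1 := by
  rw [Real.exp_neg, two_mul, Real.exp_add, Real.exp_log hx, ← div_eq_mul_inv,
    div_le_one (mul_pos hx hx)]
  exact mul_le_mul hyx hzx hz hx.le

namespace BroadcastBandit

open Strategy

variable {M N K τ : ℕ} [NeZero M] [NeZero K] {δ : ℝ}

theorem exists_strategy_regret_le (hδ : 0 < δ) (hδ1 : δ ≤ 1) (hτ : 1 ≤ τ) (hN : τ ≤ N) {Λ : ℝ}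
    (hΛ : 0 ≤ Λ) (T : ℕ) :
    ∃ π : Strategy M N K τ, ∀ B : BroadcastBandit M N K τ,
      B.UniformArrivals → B.DiscretePayoffs δ →
      B.regret π T ≤ N + M * (N / τ : ℝ) + 16 / δ ^ 2 * (M * K * (N / τ : ℝ) ^ 2 * Λ) +
        4 * T * N * M * (N / τ : ℝ) * Real.exp (-Λ) := by
  have hf : 1 ≤ N / τ := (Nat.one_le_div_iff hτ).2 hN
  have : (0 : ℝ) < (N / τ : ℕ) := by exact_mod_cast hf
  have hτ' : (0 : ℝ) < τ := by exact_mod_cast hτ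
  have hK' : (0 : ℝ) < K := by exact_mod_cast Nat.pos_of_neZero K
  have hfloor : ((N / τ : ℕ) : ℝ) ≤ N / τ := Nat.cast_div_le
  have hG2 : ((N / τ + 1 : ℕ) : ℝ) ≤ 2 * (N / τ) := by
    have hone : (1 : ℝ) ≤ N / τ := (one_le_div hτ').2 (by exact_mod_cast hN)
    push_cast
    linarith
  obtain ⟨ε, hε0, hε1, hG, hinv⟩ := exists_accuracy hδ hδ1 hf
  obtain ⟨L, hyL, hL⟩ := exists_le_div_and_le (Nat.pos_of_neZero M) hτ
    (y := K * Λ / (ε ^ 2 * (N / τ : ℕ))) (by positivity)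
  refine ⟨exploreThenCommit (roundRobin M L τ) greedy measurable_greedy, fun B hB hD => ?_⟩
  have hP : ∀ k m, B.law.real {ω | explore (roundRobin M L τ) ω ∈ B.misestimated L ε k m} ≤
      2 * Real.exp (-Λ) := by
    intro k m
    refine (hB.measureReal_misestimated_le _ k m hε0.le hε1).trans ?_
    gcongr
    calc Λ = ε ^ 2 / K * ((N / τ : ℕ) * (K * Λ / (ε ^ 2 * (N / τ : ℕ)))) := by field_simp
      _ ≤ ε ^ 2 / K * ((N / τ : ℕ) * (∑ i, #{s | roundRobin M L τ i s = m} : ℕ)) := by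
          gcongr
          exact hyL.trans (by exact_mod_cast div_le_sum_card_roundRobin L τ m)
  calc B.regret _ T ≤ L * N + T * ((N / τ + 1 : ℕ) * (N * (M * (2 * Real.exp (-Λ))))) :=
        hD.regret_exploreThenCommit_greedy_le hδ hε0.le hG _ (by positivity) hP T
    _ ≤ (M * (K * Λ * (16 / δ ^ 2 * (N / τ)) + 1) / τ + 1) * N +
          T * (2 * (N / τ) * (N * (M * (2 * Real.exp (-Λ))))) := by
        gcongr
        refine hL.trans ?_
        rw [← mul_one_div (K * Λ)]
        gcongr
        exact hinv.trans (mul_le_mul_of_nonneg_left hfloor (by positivity))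
    _ = _ := by ring

theorem exists_strategy_regret_le_of_lt {T : ℕ} (hδ : 0 < δ) (hδ1 : δ ≤ 1) (hτ : 1 ≤ τ)
    (hN : τ < N) (hF : (N : ℝ) ≤ M * N ^ 2 * K / τ ^ 2 * Real.log (M * N * K * T)) :
    ∃ π : Strategy M N K τ, ∀ B : BroadcastBandit M N K τ,
      B.UniformArrivals → B.DiscretePayoffs δ →
      B.regret π T ≤
        (11 + 32 / δ ^ 2) * (M * N ^ 2 * K / τ ^ 2 * Real.log (M * N * K * T)) := by
  have hM' : (1 : ℝ) ≤ M := by exact_mod_cast Nat.one_le_iff_ne_zero.2 (NeZero.ne M)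
  have hK' : (1 : ℝ) ≤ K := by exact_mod_cast Nat.one_le_iff_ne_zero.2 (NeZero.ne K)
  have hN' : (2 : ℝ) ≤ N := by exact_mod_cast (by omega : 2 ≤ N)
  have hT : T ≠ 0 := by
    rintro rfl
    simp only [Nat.cast_zero, mul_zero, Real.log_zero] at hF
    linarith
  have hT' : (1 : ℝ) ≤ T := by exact_mod_cast Nat.one_le_iff_ne_zero.2 hT
  have hτ' : (1 : ℝ) ≤ τ := by exact_mod_cast hτ
  have hρ1 : 1 ≤ (N / τ : ℝ) := (one_le_div (by linarith)).2 (by exact_mod_cast hN.le)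
  have hρN : (N / τ : ℝ) ≤ N := div_le_self (by linarith) hτ'
  set X : ℝ := M * N * K * T
  have hX2 : 2 ≤ X :=
    calc (2 : ℝ) = 1 * 2 * 1 * 1 := by norm_num
      _ ≤ M * N * K * T := by gcongr
  have hlog := half_le_log hX2
  rw [show (M * N ^ 2 * K / τ ^ 2 * Real.log X : ℝ) = M * K * (N / τ) ^ 2 * Real.log X by ring]
    at hF ⊢
  set ρ : ℝ := N / τ
  set F : ℝ := M * K * ρ ^ 2 * Real.log X
  have hMρ : M * ρ ≤ 2 * F :=
    calc M * ρ = M * 1 * (ρ * 1) * (2 * (1 / 2)) := by ring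
      _ ≤ M * K * (ρ * ρ) * (2 * Real.log X) := by gcongr
      _ = 2 * F := by ring
  have hNX : N ≤ X :=
    calc (N : ℝ) = 1 * N * 1 * 1 := by ring
      _ ≤ M * N * K * T := by gcongr
  have hTNM : M * N * T ≤ X :=
    calc (M * N * T : ℝ) = M * N * 1 * T := by ring
      _ ≤ M * N * K * T := by gcongr
  have hlast := mul_mul_exp_neg_two_mul_log_le_one (by positivity) hTNM
    (show (0 : ℝ) ≤ ρ by positivity) (hρN.trans hNX)
  obtain ⟨π, hπ⟩ := exists_strategy_regret_le (M := M) (K := K) hδ hδ1 hτ hN.le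
    (Λ := 2 * Real.log X) (by linarith) T
  refine ⟨π, fun B hB hD => (hπ B hB hD).trans ?_⟩
  have hmid : 16 / δ ^ 2 * (M * K * ρ ^ 2 * (2 * Real.log X)) = 32 / δ ^ 2 * F := by ring
  rw [hmid]
  linarith

theorem exists_strategy_regret_le_of_eq {T : ℕ} (hδ : 0 < δ) (hδ1 : δ ≤ 1) (hN : 1 ≤ N)
    (hT : 2 * K ≤ N * T) (hF : (N : ℝ) ≤ M * K * Real.log (N * T / K)) :
    ∃ π : Strategy M N K N, ∀ B : BroadcastBandit M N K N,
      B.UniformArrivals → B.DiscretePayoffs δ →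
      B.regret π T ≤ (11 + 32 / δ ^ 2) * (M * K * Real.log (N * T / K)) := by
  have hK' : (1 : ℝ) ≤ K := by exact_mod_cast Nat.one_le_iff_ne_zero.2 (NeZero.ne K)
  have hN' : (1 : ℝ) ≤ N := by exact_mod_cast hN
  have hNT : (N * T : ℝ) = N * T / K * K := by field_simp
  set X : ℝ := N * T / K
  have hX2 : 2 ≤ X := (le_div_iff₀ (by linarith)).2 (by exact_mod_cast hT)
  have hlog := half_le_log hX2
  set F : ℝ := M * K * Real.log X
  have hMK : M * K ≤ 2 * F :=
    calc (M * K : ℝ) = M * K * (2 * (1 / 2)) := by ring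
      _ ≤ M * K * (2 * Real.log X) := by gcongr
      _ = 2 * F := by ring
  have hM : (M : ℝ) ≤ M * K := le_mul_of_one_le_right (Nat.cast_nonneg M) hK'
  have hlast : 4 * T * N * M * X⁻¹ = 4 * (M * K) := by
    calc 4 * T * N * M * X⁻¹ = 4 * (N * T) * M * X⁻¹ := by ring
      _ = 4 * (M * K) := by rw [hNT]; field_simp
  have hmid : 16 / δ ^ 2 * F ≤ 32 / δ ^ 2 * F :=
    mul_le_mul_of_nonneg_right (by gcongr; norm_num) (by linarith)
  obtain ⟨π, hπ⟩ := exists_strategy_regret_le (M := M) (K := K) hδ hδ1 hN le_rfl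
    (Λ := Real.log X) (by linarith) T
  refine ⟨π, fun B hB hD => (hπ B hB hD).trans ?_⟩
  rw [div_self (by linarith : (N : ℝ) ≠ 0), Real.exp_neg, Real.exp_log (by linarith), one_pow,
    mul_one, mul_one, mul_one, hlast]
  linarith

end BroadcastBandit

theorem theorem2 (δ : ℝ) (hδ : 0 < δ) :
    ∃ C : ℝ, 0 < C ∧ ∀ M N K τ T : ℕ, 0 < M → 0 < K → 1 ≤ τ →
      (τ < N →
        (N : ℝ) ≤ M * N ^ 2 * K / τ ^ 2 * Real.log (M * N * K * T) →
        ∃ π : Strategy M N K τ, ∀ B : BroadcastBandit M N K τ,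
          B.UniformArrivals → B.DiscretePayoffs δ →
          B.regret π T ≤ C * (M * N ^ 2 * K / τ ^ 2 * Real.log (M * N * K * T))) ∧
      (τ = N →
        2 * K ≤ N * T →
        (N : ℝ) ≤ M * K * Real.log (N * T / K) →
        ∃ π : Strategy M N K τ, ∀ B : BroadcastBandit M N K τ,
          B.UniformArrivals → B.DiscretePayoffs δ →
          B.regret π T ≤ C * (M * K * Real.log (N * T / K))) := by
  have hδ' : 0 < min δ 1 := lt_min hδ one_pos
  refine ⟨11 + 32 / (min δ 1) ^ 2, by positivity, fun M N K τ T hM hK hτ => ?_⟩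
  have : NeZero M := ⟨hM.ne'⟩
  have : NeZero K := ⟨hK.ne'⟩
  constructor
  · intro hN hF
    obtain ⟨π, hπ⟩ :=
      BroadcastBandit.exists_strategy_regret_le_of_lt hδ' (min_le_right δ 1) hτ hN hF
    exact ⟨π, fun B hB hD => hπ B hB (hD.mono (min_le_left δ 1))⟩
  · rintro rfl hT hF
    obtain ⟨π, hπ⟩ :=
      BroadcastBandit.exists_strategy_regret_le_of_eq hδ' (min_le_right δ 1) hτ hT hF
    exact ⟨π, fun B hB hD => hπ B hB (hD.mono (min_le_left δ 1))⟩
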